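/- **Setting.** Let $G$ be a finite set of good types with integer supplies $s_j$ ($j\in G$), let $k\in\mathbb N$, and let $\mathcal B=\{B\in\mathbb Z_{\ge 0}^{G}: 1\le\sum_j B_j\le k\}$ be the set of bundles. There is a finite set $\Theta$ of agent types; an agent of type $\theta$ has valuation $u_\theta:\mathcal B\to\mathbb R$. Let $0<\delta_w<1$, $\delta_\epsilon>0$ with $2\delta_\epsilon<s_j$ for all $j$, and let $\mathrm{tol}>0$. The random draw consists of weights $w_\theta(B)$, uniform on $[1-\delta_w,1+\delta_w]$, and supply reductions $\epsilon_j$, uniform on $[\delta_\epsilon,2\delta_\epsilon]$, all independent; agents (reported to be) of the same type have the same weights. **The POPT mechanism.** Given a set $N$ of $n$ agents with reported types $(\beta_i)_{i\in N}$ and a draw, put $v_i(B)=w_{\beta_i}(B)u_{\beta_i}(B)$ and consider the linear program (LIP) $$\max_{x\ge 0}\ \sum_{i,B}v_i(B)x_i(B)\quad\text{s.t.}\quad \sum_B x_i(B)\le 1\ (i\in N),\qquad \sum_{i,B}B_jx_i(B)\le s_j-\epsilon_j\ (j\in G).$$ 1. Take an optimal solution $x^*$ of (LIP), and prices $p$ such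 that $(\alpha,p)$ is, for some $\alpha$, an optimal solution of the dual program: $\min_{\alpha,p\ge 0}\sum_i\alpha_i+\sum_j(s_j-\epsilon_j)p_j$ subject to $\alpha_i\ge v_i(B)-\sum_jB_jp_j$ for all $i,B$. The price of a bundle $B$ is $p(B)=\sum_jB_jp_j$. 2. *Iterative rounding* $\mathrm{IR}(z;c)$ of a point $z$ with reward vector $c$: let $N_0=\{i:\sum_Bz_i(B)=1\}$ and start with all supply constraints (with supplies $s_j$) active. While the current point $z$ is not integral, replace it by an extreme point $z'$ that maximizes $\langle c,x\rangle$ over all $x\ge0$ such that $x_i(B)=z_i(B)$ for every entry of $z$ that is not strictly between $0$ and $1$, $\sum_Bx_i(B)=1$ for $i\in N_0$, $\sum_Bx_i(B)\le1$ for $i\notin N_0$, and $x$ satisfies the active supply constraints. If no entry that was fractional in $z$ has become integral in $z'$, then keep active only those active $j$ for which $\sum_{(i,B)\in R}B_j>\lceil s_j-\sum_{(i,B)\notin R}B_jz_i(B)\rceil+k-1$, where $R$ is the set of fractional entries of $z$. 3. *Lottery construction*: start with $F=\{\mathrm{IR}(x^*;v),\mathrm{IR}(x^*;-v)\}$. Let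 $y$ be the point of $\mathrm{conv}F$ nearest to $x^*$ in Euclidean norm. If $\|y-x^*\|<\mathrm{tol}$, stop. Otherwise choose a minimal $F'\subseteq F$ with $y$ in the relative interior of $\mathrm{conv}F'$, put $z=x^*+\delta\,\frac{x^*-y}{\|x^*-y\|}$, where $0<\delta\le\delta_z:=\delta_\epsilon/\sqrt{n\sum_BB_j^2}$ ($\delta_z$ does not depend on $j$) is such that $z\ge0$, $\sum_B z_i(B)\le1$ for all $i$ and $\sum_{i,B}B_jz_i(B)\le s_j$ for all $j$, replace $F$ by $F'\cup\{\mathrm{IR}(z;x^*-y)\}$, and repeat. When the construction stops, the integral allocation $\overline x$ is drawn from a probability distribution on $F$ with mean $y$. Any rule may be used for the choices left open here (which optimal solutions are taken, which $F'$, $\delta$, and distribution), as long as the prices and the lottery probabilities depend measurably on the draw. **Theorem.** Let the acceptable error $\epsilon_u>0$ satisfy $2\delta_w\,u_\theta(B)\le\epsilon_u$ for all $\theta\in\Theta$, $B\in\mathcal B$. Then every such mechanism is asymptotically strategy-proof: for every $\varepsilon_0>0$ there is $N_0\in\mathbb N$ such that for every finite population of agents with true types $(\beta_i)$ in which every type $\theta\in\Theta$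 has $n_\theta>N_0$ agents, every agent $i$ and every type $\zeta\in\Theta$, $$\mathbb E\Big[\sum_{B\in\mathcal B}\big(u_{\beta_i}(B)-\overline p(B)\big)\overline x_i(B)\Big]\ \ge\ \mathbb E\Big[\sum_{B\in\mathcal B}\big(u_{\beta_i}(B)-\tilde p(B)\big)\tilde x_i(B)\Big]-\epsilon_u-\varepsilon_0,$$ where $(\overline x,\overline p)$ is the result when all agents report truthfully, $(\tilde x,\tilde p)$ is the result when agent $i$ reports $\zeta$ and all others report truthfully, and the expectations, over the draw and the lottery, exist. -/

import Mathlib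

open MeasureTheory

namespace POPT

/-- The nonempty `k`-bundles: vectors of nonnegative integers indexed by the good types `G`,
of size (number of goods, with multiplicity) between `1` and `k`. -/
def Bundle (G : Type*) [Fintype G] (k : ℕ) : Type _ :=
  {B : G → ℕ // 1 ≤ ∑ j, B j ∧ ∑ j, B j ≤ k}

theorem Bundle.finite (G : Type*) [Fintype G] (k : ℕ) : Finite (Bundle G k) := by
  have hle : ∀ (B : Bundle G k) (j : G), B.1 j < k + 1 := fun B j =>
    Nat.lt_succ_of_le
      ((Finset.single_le_sum (f := B.1) (fun _ _ => Nat.zero_le _) (Finset.mem_univ j)).trans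
        B.2.2)
  refine Finite.of_injective
    (fun (B : Bundle G k) (j : G) => (⟨B.1 j, hle B j⟩ : Fin (k + 1))) ?_
  intro B C h
  apply Subtype.ext
  funext j
  exact congrArg Fin.val (congrFun h j)

noncomputable instance (G : Type*) [Fintype G] (k : ℕ) : Fintype (Bundle G k) :=
  @Fintype.ofFinite _ (Bundle.finite G k)

noncomputable instance (G : Type*) [Fintype G] (k : ℕ) : DecidableEq (Bundle G k) :=
  Classical.decEq _

/-- The data of an auction with agent types `Θ` and good types `G`: the bundle size bound `k`,
the integral supplies `s`, the valuation `u θ` of each type, the half-width `δw` of the random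
weights, the scale `δε` of the random supply reductions, and the tolerance `tol` of the lottery
construction. -/
structure Auction (Θ G : Type*) [Fintype G] where
  k : ℕ
  s : G → ℕ
  u : Θ → Bundle G k → ℝ
  δw : ℝ
  δε : ℝ
  tol : ℝ

section LinearPrograms

variable {N G : Type*} [Fintype N] [Fintype G] {k : ℕ}

/-- `∑ i, ∑ B, c i B * x i B`. -/
noncomputable def value (c x : N → Bundle G k → ℝ) : ℝ :=
  ∑ i, ∑ B, c i B * x i B

/-- The amount of good `j` used by a (fractional) allocation. -/
noncomputable def usage (x : N → Bundle G k → ℝ) (j : G) : ℝ :=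
  ∑ i, ∑ B, (B.1 j : ℝ) * x i B

/-- Nonnegative, (Demand), and (Supply) with supply vector `σ`. -/
def Feasible (σ : G → ℝ) (x : N → Bundle G k → ℝ) : Prop :=
  (∀ i B, 0 ≤ x i B) ∧ (∀ i, ∑ B, x i B ≤ 1) ∧ ∀ j, usage x j ≤ σ j

/-- `x` is an optimal solution of the allocation linear program with objective coefficients `v`
and supply vector `σ`. -/
def IsPrimalOptimal (v : N → Bundle G k → ℝ) (σ : G → ℝ) (x : N → Bundle G k → ℝ) : Prop :=
  Feasible σ x ∧ ∀ x', Feasible σ x' → value v x' ≤ value v x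

/-- The linear price of a bundle. -/
noncomputable def price (p : G → ℝ) (B : Bundle G k) : ℝ :=
  ∑ j, (B.1 j : ℝ) * p j

/-- Feasibility for the dual linear program. -/
def DualFeasible (v : N → Bundle G k → ℝ) (α : N → ℝ) (p : G → ℝ) : Prop :=
  (∀ i, 0 ≤ α i) ∧ (∀ j, 0 ≤ p j) ∧ ∀ i B, v i B - price p B ≤ α i

/-- The objective of the dual linear program. -/
noncomputable def dualValue (σ : G → ℝ) (α : N → ℝ) (p : G → ℝ) : ℝ :=
  ∑ i, α i + ∑ j, σ j * p j

/-- `(α, p)` is an optimal solution of the dual linear program. -/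
def IsDualOptimal (v : N → Bundle G k → ℝ) (σ : G → ℝ) (α : N → ℝ) (p : G → ℝ) : Prop :=
  DualFeasible v α p ∧ ∀ α' p', DualFeasible v α' p' → dualValue σ α p ≤ dualValue σ α' p'

end LinearPrograms

section IterativeRounding

variable {N G : Type*} [Fintype N] [Fintype G] {k : ℕ}

/-- All entries are `0` or `1`. -/
def IsIntegral (x : N → Bundle G k → ℝ) : Prop :=
  ∀ i B, x i B = 0 ∨ x i B = 1

/-- The entry of `z` for agent `i` and bundle `B` is strictly fractional. -/
def Fractional (z : N → Bundle G k → ℝ) (i : N) (B : Bundle G k) : Prop :=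
  0 < z i B ∧ z i B < 1

/-- The feasible region of the updated linear program in a round that starts at `z`: the entries
of `z` that are not fractional are frozen, the demand constraints of the agents in `N₀` are
equalities, and only the supply constraints of the goods in `A` are kept. -/
def ulipRegion (σ : G → ℝ) (N₀ : Set N) (A : Set G) (z : N → Bundle G k → ℝ) :
    Set (N → Bundle G k → ℝ) :=
  {x | (∀ i B, 0 ≤ x i B) ∧
    (∀ i B, ¬ Fractional z i B → x i B = z i B) ∧
    (∀ i ∈ N₀, ∑ B, x i B = 1) ∧
    (∀ i, i ∉ N₀ → ∑ B, x i B ≤ 1) ∧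
    ∀ j ∈ A, usage x j ≤ σ j}

open Classical in
/-- The supply constraint of good `j` stays active after a round that started at `z` and fixed
no new entry: the fractional bundles together contain more than `⌈s'⌉ + k - 1` units of good `j`,
where `s'` is the supply left over by the frozen entries. -/
def StaysActive (σ : G → ℝ) (z : N → Bundle G k → ℝ) (j : G) : Prop :=
  ⌈σ j - ∑ i, ∑ B : Bundle G k,
      (if Fractional z i B then 0 else (B.1 j : ℝ) * z i B)⌉ + (k : ℤ) - 1
    < ∑ i, ∑ B : Bundle G k, (if Fractional z i B then (B.1 j : ℤ) else 0)

/-- One round of iterative rounding with reward vector `c`; the state is the current point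
together with the set of goods whose supply constraint is active. -/
def IRStep (σ : G → ℝ) (c : N → Bundle G k → ℝ) (N₀ : Set N)
    (st st' : (N → Bundle G k → ℝ) × Set G) : Prop :=
  ¬ IsIntegral st.1 ∧
  st'.1 ∈ Set.extremePoints ℝ (ulipRegion σ N₀ st.2 st.1) ∧
  (∀ x ∈ ulipRegion σ N₀ st.2 st.1, value c x ≤ value c st'.1) ∧
  ((∃ i B, Fractional st.1 i B ∧ ¬ Fractional st'.1 i B) → st'.2 = st.2) ∧
  ((¬ ∃ i B, Fractional st.1 i B ∧ ¬ Fractional st'.1 i B) →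
    st'.2 = {j ∈ st.2 | StaysActive σ st.1 j})

/-- `x` is a possible output of iterative rounding on the input `z`, with reward vector `c`
(the linear programs may have several optimal extreme points). -/
def IsIR (σ : G → ℝ) (z c x : N → Bundle G k → ℝ) : Prop :=
  ∃ A : Set G,
    Relation.ReflTransGen (IRStep σ c {i | ∑ B, z i B = 1}) (z, Set.univ) (x, A) ∧ IsIntegral x

end IterativeRounding

section LotteryConstruction

variable {N G : Type*} [Fintype N] [Fintype G] {k : ℕ}

/-- Euclidean distance. -/
noncomputable def l2dist (x y : N → Bundle G k → ℝ) : ℝ :=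
  Real.sqrt (∑ i, ∑ B, (x i B - y i B) ^ 2)

/-- `y` is the point of the convex hull of `F` nearest to `x`. -/
def IsNearest (F : Set (N → Bundle G k → ℝ)) (x y : N → Bundle G k → ℝ) : Prop :=
  y ∈ convexHull ℝ F ∧ ∀ y' ∈ convexHull ℝ F, l2dist x y ≤ l2dist x y'

/-- The step length `δ_z`; its value does not depend on the good `j`. -/
noncomputable def stepLength (N : Type*) [Fintype N] {G : Type*} [Fintype G] (k : ℕ) (δε : ℝ)
    (j : G) : ℝ :=
  δε / Real.sqrt ((Fintype.card N : ℝ) * ∑ B : Bundle G k, (B.1 j : ℝ) ^ 2)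

/-- One round of the lottery construction for `x`, on the current set of integral points.  The
step from `x` away from the nearest point `y` has length `δ_z`, or less where this is needed to
make the new point `z` nonnegative and feasible for (Demand) and (Supply). -/
def LotteryStep (σ : G → ℝ) (δε tol : ℝ) (x : N → Bundle G k → ℝ)
    (F F₂ : Set (N → Bundle G k → ℝ)) : Prop :=
  ∃ (y : N → Bundle G k → ℝ) (F' : Set (N → Bundle G k → ℝ)) (δ : ℝ)
    (z zbar : N → Bundle G k → ℝ),
    IsNearest F x y ∧ tol ≤ l2dist x y ∧
    Minimal (fun E => E ⊆ F ∧ y ∈ intrinsicInterior ℝ (convexHull ℝ E)) F' ∧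
    0 < δ ∧ (∀ j : G, δ ≤ stepLength N k δε j) ∧
    z = x + (δ / l2dist x y) • (x - y) ∧ Feasible σ z ∧
    IsIR σ z (x - y) zbar ∧
    F₂ = insert zbar F'

/-- `F` can be reached by the lottery construction for `x` (with objective coefficients `v`). -/
def IsLotterySet (v : N → Bundle G k → ℝ) (σ : G → ℝ) (δε tol : ℝ)
    (x : N → Bundle G k → ℝ) (F : Set (N → Bundle G k → ℝ)) : Prop :=
  ∃ x' x'', IsIR σ x v x' ∧ IsIR σ x (-v) x'' ∧
    Relation.ReflTransGen (LotteryStep σ δε tol x) {x', x''} F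

/-- The `0`-`1` allocation given by a Boolean matrix. -/
def ofBool (a : N → Bundle G k → Bool) : N → Bundle G k → ℝ :=
  fun i B => if a i B then 1 else 0

/-- `lam` is a possible final lottery of the lottery construction for `x`: the construction has
stopped at a set `F` whose convex hull comes within `tol` of `x`, and `lam` is a probability
distribution on `F` whose mean is the point of the convex hull nearest to `x`. -/
def IsLottery [DecidableEq N] (v : N → Bundle G k → ℝ) (σ : G → ℝ) (δε tol : ℝ)
    (x : N → Bundle G k → ℝ) (lam : (N → Bundle G k → Bool) → ℝ) : Prop :=
  ∃ (F : Set (N → Bundle G k → ℝ)) (y : N → Bundle G k → ℝ),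
    IsLotterySet v σ δε tol x F ∧ IsNearest F x y ∧ l2dist x y < tol ∧
    (∀ a, 0 ≤ lam a) ∧ (∀ a, lam a ≠ 0 → ofBool a ∈ F) ∧
    ∑ a, lam a = 1 ∧ ∑ a, lam a • ofBool a = y

end LotteryConstruction

section Mechanisms

variable {Θ G : Type*} [Fintype G]

/-- The random draw of the mechanism: a weight for every type and bundle (so that agents of the
same type have the same weights), and a supply reduction for every good. -/
abbrev Draw (Θ : Type*) {G : Type*} [Fintype G] (k : ℕ) : Type _ :=
  (Θ × Bundle G k → ℝ) × (G → ℝ)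

/-- The uniform distribution on `[a, b]`. -/
noncomputable def unif (a b : ℝ) : Measure ℝ :=
  ProbabilityTheory.cond volume (Set.Icc a b)

/-- The law of the draw: all weights are uniform on `[1 - δw, 1 + δw]`, all supply reductions are
uniform on `[δε, 2 δε]`, and all of them are independent. -/
noncomputable def drawLaw [Fintype Θ] (P : Auction Θ G) : Measure (Draw Θ (G := G) P.k) :=
  (Measure.pi fun _ : Θ × Bundle G P.k => unif (1 - P.δw) (1 + P.δw)).prod
    (Measure.pi fun _ : G => unif P.δε (2 * P.δε))

/-- The result of a mechanism with `n` agents for one draw: prices of the goods and the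
probabilities of the integral allocations in the lottery. -/
structure Outcome (G : Type*) [Fintype G] (k n : ℕ) where
  prices : G → ℝ
  lottery : (Fin n → Bundle G k → Bool) → ℝ

/-- A mechanism turns the reported types of any number of agents, and the draw, into a result. -/
abbrev Mechanism (Θ : Type*) (G : Type*) [Fintype G] (k : ℕ) : Type _ :=
  ∀ n : ℕ, (Fin n → Θ) → Draw Θ (G := G) k → Outcome G k n

/-- The objective coefficients `w_i(B) u_i(B)` for the reported types `β`. -/
def weighted (P : Auction Θ G) {n : ℕ} (β : Fin n → Θ) (d : Draw Θ (G := G) P.k) :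
    Fin n → Bundle G P.k → ℝ :=
  fun i B => d.1 (β i, B) * P.u (β i) B

/-- The reduced supplies `s_j - ε_j`. -/
def reducedSupply (P : Auction Θ G) (d : Draw Θ (G := G) P.k) : G → ℝ :=
  fun j => (P.s j : ℝ) - d.2 j

/-- `o` is a possible result of the POPT mechanism for the reports `β` and the draw `d`: the
lottery comes from the lottery construction for some optimal solution of the linear program, and
the prices are the supply part of some optimal solution of its dual. -/
def IsPOPTOutcome (P : Auction Θ G) {n : ℕ} (β : Fin n → Θ) (d : Draw Θ (G := G) P.k)
    (o : Outcome G P.k n) : Prop :=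
  (∃ x, IsPrimalOptimal (weighted P β d) (reducedSupply P d) x ∧
    IsLottery (weighted P β d) (fun j => (P.s j : ℝ)) P.δε P.tol x o.lottery) ∧
  ∃ α, IsDualOptimal (weighted P β d) (reducedSupply P d) α o.prices

/-- `M` is a POPT mechanism: for almost every draw its result is one of the possible results of
POPT, and it depends measurably on the draw. -/
def IsPOPT [Fintype Θ] (P : Auction Θ G) (M : Mechanism Θ G P.k) : Prop :=
  ∀ (n : ℕ) (β : Fin n → Θ),
    (∀ᵐ d ∂drawLaw P, IsPOPTOutcome P β d (M n β d)) ∧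
    (∀ j, AEMeasurable (fun d => (M n β d).prices j) (drawLaw P)) ∧
    ∀ a, AEMeasurable (fun d => (M n β d).lottery a) (drawLaw P)

/-- The expectation over the lottery of the payoff `∑ B, (u_θ(B) - p(B)) x_i(B)` of agent `i`,
whose true type is `θ`. -/
noncomputable def payoff (P : Auction Θ G) {n : ℕ} (θ : Θ) (i : Fin n) (o : Outcome G P.k n) : ℝ :=
  ∑ a, o.lottery a * ∑ B, (P.u θ B - price o.prices B) * ofBool a i B

/-- Asymptotic strategy-proofness with acceptable error `εu`.  The expectation is over the draw
and the lottery; agent `i` evaluates both outcomes with its true type `β i`. -/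
def AsymptoticallyStrategyProof [Fintype Θ] [DecidableEq Θ] (P : Auction Θ G)
    (M : Mechanism Θ G P.k) (εu : ℝ) : Prop :=
  ∀ ε₀ : ℝ, 0 < ε₀ → ∃ N₀ : ℕ, ∀ (n : ℕ) (β : Fin n → Θ),
    (∀ θ, N₀ < Fintype.card {i // β i = θ}) →
    ∀ (i : Fin n) (ζ : Θ),
      Integrable (fun d => payoff P (β i) i (M n β d)) (drawLaw P) ∧
      Integrable (fun d => payoff P (β i) i (M n (Function.update β i ζ) d)) (drawLaw P) ∧
      ∫ d, payoff P (β i) i (M n (Function.update β i ζ) d) ∂drawLaw P - εu - ε₀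
        ≤ ∫ d, payoff P (β i) i (M n β d) ∂drawLaw P

end Mechanisms

end POPT

/-! Complementary slackness bounds both payoffs by half of the acceptable error; no convergence of
prices is needed. A population threshold just above the total supply works for every `ε₀`.

Truthful report: rounding and the lottery never leave the support of the optimal LP solution `x`
(`IsLotterySet.subset_demandFace`). On that support the weighted valuation `w u` equals `α + p(B)`,
hence is at least `p(B)`. So a bundle received satisfies `u - p(B) ≥ (1 - w) u ≥ -δw u ≥ -εu/2`
(`neg_half_le_payoff`).

Misreport: more agents still report the true type `θ` than there are goods, and bundles are
nonempty, so one of them is not fully served. Its dual variable `α` vanishes, and dual feasibility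
gives `p(B) ≥ w u` for every bundle (`weighted_le_price`). So no bundle yields more than `εu/2`
(`payoff_le_half`).

Complementary slackness rests on strong duality, obtained by separating convex sets, with the zero
allocation as Slater point. -/

namespace POPT

/-! ### Linear programming duality by separation -/

/-- Strong duality for linear programs in which `x = 0` is strictly feasible: the dual program
has a feasible point whose value is at most the optimal value of the primal program. -/
theorem exists_dual_of_isOptimal {ι κ : Type*} [Fintype ι] [Fintype κ]
    (A : κ → ι → ℝ) (b : κ → ℝ) (c : ι → ℝ) (m : ℝ) (hb : ∀ k, 0 < b k)
    (hopt : ∀ x : ι → ℝ, (∀ i, 0 ≤ x i) → (∀ k, ∑ i, A k i * x i ≤ b k) →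
      ∑ i, c i * x i ≤ m) :
    ∃ y : κ → ℝ, (∀ k, 0 ≤ y k) ∧ (∀ i, c i ≤ ∑ k, y k * A k i) ∧ ∑ k, b k * y k ≤ m := by
  classical
  -- Pairs of a constraint relaxation and a gain over `m` that some `x ≥ 0` strictly beats.
  -- Strictness makes `S` open, and optimality keeps the origin out of it.
  let S : Set ((κ → ℝ) × ℝ) := {q | ∃ x : ι → ℝ, (∀ i, 0 ≤ x i) ∧
    (∀ k, ∑ i, A k i * x i - b k < q.1 k) ∧ q.2 < ∑ i, c i * x i - m}
  have hSconv : Convex ℝ S := by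
    rintro q ⟨x, hx0, hx1, hx2⟩ q' ⟨x', hx0', hx1', hx2'⟩ s t hs ht hst
    have hlin : ∀ a : ι → ℝ, ∑ i, a i * (s * x i + t * x' i)
        = s * ∑ i, a i * x i + t * ∑ i, a i * x' i := fun a => by
      rw [Finset.mul_sum, Finset.mul_sum, ← Finset.sum_add_distrib]
      exact Finset.sum_congr rfl fun i _ => by ring
    have hcomb : ∀ a a' d d' : ℝ, a < d → a' < d' → s * a + t * a' < s * d + t * d' := by
      intro a a' d d' h h'
      rcases hs.eq_or_lt with rfl | hs
      · have : t = 1 := by linarith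
        subst this; linarith
      · nlinarith [mul_lt_mul_of_pos_left h hs, mul_le_mul_of_nonneg_left h'.le ht]
    refine ⟨fun i => s * x i + t * x' i, fun i => ?_, fun k => ?_, ?_⟩
    · have := mul_nonneg hs (hx0 i)
      have := mul_nonneg ht (hx0' i)
      linarith
    · have h := hcomb _ _ _ _ (hx1 k) (hx1' k)
      have hbk : b k = s * b k + t * b k := by rw [← add_mul, hst, one_mul]
      rw [hlin]
      simp only [Prod.fst_add, Prod.smul_fst, Pi.add_apply, Pi.smul_apply, smul_eq_mul]
      linarith
    · have h := hcomb _ _ _ _ hx2 hx2'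
      have hm : m = s * m + t * m := by rw [← add_mul, hst, one_mul]
      rw [hlin]
      simp only [Prod.snd_add, Prod.smul_snd, smul_eq_mul]
      linarith
  have hSopen : IsOpen S := by
    have : S = ⋃ x ∈ {x : ι → ℝ | ∀ i, 0 ≤ x i},
        ((⋂ k, {q : (κ → ℝ) × ℝ | ∑ i, A k i * x i - b k < q.1 k}) ∩
          {q | q.2 < ∑ i, c i * x i - m}) := by
      ext q
      simp [S, and_left_comm]
    rw [this]
    refine isOpen_biUnion fun x _ => IsOpen.inter (isOpen_iInter_of_finite fun k => ?_) ?_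
    · exact isOpen_lt continuous_const (by fun_prop)
    · exact isOpen_lt (by fun_prop) continuous_const
  have h0 : (0 : (κ → ℝ) × ℝ) ∉ S := by
    rintro ⟨x, hx0, hx1, hx2⟩
    have h := hopt x hx0 fun k => by
      have := hx1 k
      simp only [Prod.fst_zero, Pi.zero_apply] at this
      linarith
    simp only [Prod.snd_zero] at hx2
    linarith
  obtain ⟨f, hf⟩ := geometric_hahn_banach_open_point hSconv hSopen h0
  let e : κ → ℝ := fun k => f (Pi.single k 1, 0)
  let μ : ℝ := f (0, 1)
  have hfe : ∀ t r, f (t, r) = ∑ k, t k * e k + r * μ := by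
    intro t r
    have h1 : ((t, r) : (κ → ℝ) × ℝ)
        = ∑ k, t k • ((Pi.single k 1, 0) : (κ → ℝ) × ℝ) + r • (0, 1) := by
      ext k
      · simp [Prod.fst_sum, Finset.sum_apply, Pi.single_apply]
      · simp [Prod.snd_sum]
    rw [h1, map_add, map_sum]
    simp only [map_smul, smul_eq_mul, e, μ]
  have hneg : ∀ t r, (t, r) ∈ S → ∑ k, t k * e k + r * μ < 0 := by
    intro t r h
    have := hf _ h
    rwa [map_zero, hfe] at this
  -- The point `x = 0` puts an entire orthant into `S`; as `b > 0`, it contains points with all `t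
  -- k` negative.
  have hzero : ∀ (t : κ → ℝ) (r : ℝ), (∀ k, -b k < t k) → r < -m →
      ∑ k, t k * e k + r * μ < 0 := fun t r ht hr =>
    hneg t r ⟨0, by simp, by simpa using ht, by simpa using hr⟩
  have he : ∀ k, e k ≤ 0 := by
    intro k
    by_contra! hk
    set R : ℝ := (-m - 1) * μ
    have h := hzero (Pi.single k (|R| / e k)) (-m - 1) (fun l => ?_) (by linarith)
    · have hsum : ∑ l, (Pi.single k (|R| / e k) : κ → ℝ) l * e l = |R| := by
        simp [Pi.single_apply, hk.ne']
      rw [hsum] at h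
      linarith [neg_abs_le R]
    · have hnn : 0 ≤ (Pi.single k (|R| / e k) : κ → ℝ) l := by
        rw [Pi.single_apply]
        split_ifs
        · positivity
        · rfl
      linarith [hb l]
  -- Slater's condition at work: if `μ ≤ 0`, the functional would be nonnegative at a point of `S`
  -- with `t = -b / 2`.
  have hhalf : 0 ≤ ∑ k, (-b k / 2) * e k := Finset.sum_nonneg fun k _ => by
    nlinarith [hb k, he k]
  have hμ : 0 < μ := by
    by_contra! hμ
    have h := hzero (fun k => -b k / 2) (-|m| - 1) (fun k => by linarith [hb k])
      (by linarith [le_abs_self m])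
    nlinarith [abs_nonneg m]
  have hmain : ∀ x : ι → ℝ, (∀ i, 0 ≤ x i) →
      ∑ k, (∑ i, A k i * x i - b k) * e k + (∑ i, c i * x i - m) * μ ≤ 0 := by
    intro x hx
    refine le_of_forall_pos_lt_add fun ε hε => ?_
    -- Shifting every coordinate by `ε / D` moves a boundary point into `S` and changes the
    -- functional by exactly `ε`.
    set D : ℝ := -∑ k, e k + μ
    have hD : 0 < D := by
      have := Finset.sum_nonpos fun k (_ : k ∈ Finset.univ) => he k
      simp only [D]
      linarith
    have h := hneg (fun k => ∑ i, A k i * x i - b k + ε / D) (∑ i, c i * x i - m - ε / D)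
      ⟨x, hx, fun k => by simpa using div_pos hε hD, by simpa using div_pos hε hD⟩
    have hs : ∑ k, (∑ i, A k i * x i - b k + ε / D) * e k
        = ∑ k, (∑ i, A k i * x i - b k) * e k + ε / D * ∑ k, e k := by
      rw [Finset.mul_sum, ← Finset.sum_add_distrib]
      exact Finset.sum_congr rfl fun k _ => by ring
    rw [hs] at h
    have hDε : ε / D * D = ε := by field_simp
    simp only [D] at hDε h ⊢
    nlinarith
  refine ⟨fun k => -e k / μ, fun k => div_nonneg (neg_nonneg.2 (he k)) hμ.le, fun i => ?_, ?_⟩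
  · by_contra! hi
    set g : ℝ := ∑ k, -e k / μ * A k i
    have hgμ : g * μ = -∑ k, A k i * e k := by
      rw [Finset.sum_mul, ← Finset.sum_neg_distrib]
      exact Finset.sum_congr rfl fun k _ => by field_simp
    -- A violated dual constraint `i` makes `hmain` fail far out on the `i`-th axis; the distance is
    -- chosen so that `hmain` reads `|K| + 1 ≤ K`.
    set K : ℝ := ∑ k, b k * e k + m * μ
    have hc : 0 < (c i - g) * μ := mul_pos (sub_pos.2 hi) hμ
    have h := hmain (Pi.single i ((|K| + 1) / ((c i - g) * μ))) fun l => by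
      rw [Pi.single_apply]
      split_ifs
      · positivity
      · rfl
    set T : ℝ := (|K| + 1) / ((c i - g) * μ)
    have hT : T * ((c i - g) * μ) = |K| + 1 := div_mul_cancel₀ _ hc.ne'
    have h1 : ∀ a : ι → ℝ, ∑ l, a l * (Pi.single i T : ι → ℝ) l = a i * T := fun a => by
      simp [Pi.single_apply]
    simp only [h1] at h
    have h2 : ∑ k, (A k i * T - b k) * e k = T * ∑ k, A k i * e k - ∑ k, b k * e k := by
      rw [Finset.mul_sum, ← Finset.sum_sub_distrib]
      exact Finset.sum_congr rfl fun k _ => by ring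
    rw [h2] at h
    have h3 : T * ((c i - g) * μ) = c i * T * μ + T * ∑ k, A k i * e k := by
      rw [sub_mul, hgμ]; ring
    have h4 : K = ∑ k, b k * e k + m * μ := rfl
    linarith [le_abs_self K]
  · have h := hmain 0 fun i => le_rfl
    simp only [Pi.zero_apply, mul_zero, Finset.sum_const_zero, zero_sub] at h
    have h1 : ∑ k, b k * (-e k / μ) = (∑ k, -b k * e k) / μ := by
      rw [Finset.sum_div]
      exact Finset.sum_congr rfl fun k _ => by ring
    rw [h1, div_le_iff₀ hμ]
    linarith

/-! ### Complementary slackness and prices in the allocation program -/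

section LinearPrograms

variable {N G : Type*} [Fintype N] [Fintype G] {k : ℕ}

/-- Strong duality for the allocation linear program with positive supplies. -/
theorem exists_dualFeasible_dualValue_le {v : N → Bundle G k → ℝ} {σ : G → ℝ}
    {x : N → Bundle G k → ℝ} (hσ : ∀ j, 0 < σ j) (hx : IsPrimalOptimal v σ x) :
    ∃ α p, DualFeasible v α p ∧ dualValue σ α p ≤ value v x := by
  classical
  obtain ⟨y, hy0, hy1, hy2⟩ := exists_dual_of_isOptimal (ι := N × Bundle G k) (κ := N ⊕ G)
    (fun c q => Sum.elim (fun i => if i = q.1 then 1 else 0) (fun j => (q.2.1 j : ℝ)) c)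
    (Sum.elim (fun _ => 1) σ) (fun q => v q.1 q.2) (value v x)
    (by rintro (i | j) <;> simp [hσ]) (fun x' h0 h1 => by
      have hf : Feasible σ (fun i B => x' (i, B)) := by
        refine ⟨fun i B => h0 _, fun i => ?_, fun j => ?_⟩
        · have := h1 (Sum.inl i)
          simpa [Fintype.sum_prod_type, Finset.sum_ite_eq, ite_mul,
            Finset.sum_comm (s := (Finset.univ : Finset N))] using this
        · simpa [usage, Fintype.sum_prod_type] using h1 (Sum.inr j)
      simpa [value, Fintype.sum_prod_type] using hx.2 _ hf)
  refine ⟨fun i => y (Sum.inl i), fun j => y (Sum.inr j),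
    ⟨fun i => hy0 _, fun j => hy0 _, fun i B => ?_⟩, ?_⟩
  · have h := hy1 (i, B)
    simp only [Fintype.sum_sum_type, Sum.elim_inl, Sum.elim_inr, mul_ite, mul_one, mul_zero,
      Finset.sum_ite_eq', Finset.mem_univ, if_true] at h
    have hp : price (fun j => y (Sum.inr j)) B = ∑ j, y (Sum.inr j) * (B.1 j : ℝ) :=
      Finset.sum_congr rfl fun j _ => mul_comm _ _
    rw [hp]
    linarith
  · simpa [dualValue, Fintype.sum_sum_type] using hy2

/-- Revenue counted by bundles equals revenue counted by goods. This links dual prices to the supply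
constraints; unit prices count the goods handed out. -/
theorem sum_price_mul (p : G → ℝ) (x : N → Bundle G k → ℝ) :
    ∑ i, ∑ B, price p B * x i B = ∑ j, usage x j * p j := by
  simp only [price, usage, Finset.sum_mul]
  rw [Finset.sum_comm (s := (Finset.univ : Finset G))]
  refine Finset.sum_congr rfl fun i _ => ?_
  rw [Finset.sum_comm (s := (Finset.univ : Finset G))]
  exact Finset.sum_congr rfl fun B _ => Finset.sum_congr rfl fun j _ => by ring

/-- Complementary slackness for the allocation linear program. -/
theorem complementary_slackness {v : N → Bundle G k → ℝ} {σ : G → ℝ}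
    {x : N → Bundle G k → ℝ} {α : N → ℝ} {p : G → ℝ} (hσ : ∀ j, 0 < σ j)
    (hx : IsPrimalOptimal v σ x) (hp : IsDualOptimal v σ α p) :
    (∀ i, ∑ B, x i B < 1 → α i = 0) ∧ ∀ i B, x i B ≠ 0 → v i B = α i + price p B := by
  obtain ⟨⟨hx0, hx1, hx2⟩, -⟩ := id hx
  obtain ⟨⟨hα, hp0, hv⟩, hmin⟩ := hp
  obtain ⟨α', p', hf, hle⟩ := exists_dualFeasible_dualValue_le hσ hx
  have hle : dualValue σ α p ≤ value v x := (hmin _ _ hf).trans hle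
  have hgap : ∀ i B, 0 ≤ (α i + price p B - v i B) * x i B := fun i B =>
    mul_nonneg (by linarith [hv i B]) (hx0 i B)
  have hdem : ∀ i, 0 ≤ α i * (1 - ∑ B, x i B) := fun i =>
    mul_nonneg (hα i) (by linarith [hx1 i])
  have hsup : ∑ j, usage x j * p j ≤ ∑ j, σ j * p j :=
    Finset.sum_le_sum fun j _ => mul_le_mul_of_nonneg_right (hx2 j) (hp0 j)
  -- The duality gap is the sum of three nonnegative parts: slack in the dual constraints, in demand
  -- and in supply. Strong duality makes it at most zero, so each term vanishes.
  have hsplit : ∑ i, ∑ B, (α i + price p B - v i B) * x i B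
      = ∑ i, α i * ∑ B, x i B + ∑ j, usage x j * p j - value v x := by
    rw [← sum_price_mul, value, ← Finset.sum_add_distrib, ← Finset.sum_sub_distrib]
    refine Finset.sum_congr rfl fun i _ => ?_
    rw [Finset.mul_sum, ← Finset.sum_add_distrib, ← Finset.sum_sub_distrib]
    exact Finset.sum_congr rfl fun B _ => by ring
  have hsplit' : ∑ i, α i * (1 - ∑ B, x i B) = ∑ i, α i - ∑ i, α i * ∑ B, x i B := by
    rw [← Finset.sum_sub_distrib]
    exact Finset.sum_congr rfl fun i _ => by ring
  have hgap' : 0 ≤ ∑ i, ∑ B, (α i + price p B - v i B) * x i B :=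
    Finset.sum_nonneg fun i _ => Finset.sum_nonneg fun B _ => hgap i B
  have hdem' : 0 ≤ ∑ i, α i * (1 - ∑ B, x i B) := Finset.sum_nonneg fun i _ => hdem i
  rw [dualValue] at hle
  constructor
  · intro i hi
    have h0 : ∑ i, α i * (1 - ∑ B, x i B) = 0 := by linarith
    have h := (Finset.sum_eq_zero_iff_of_nonneg fun i _ => hdem i).1 h0 i (Finset.mem_univ i)
    exact (mul_eq_zero.1 h).resolve_right (by linarith)
  · intro i B hB
    have h0 : ∑ i, ∑ B, (α i + price p B - v i B) * x i B = 0 := by linarith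
    have h := (Finset.sum_eq_zero_iff_of_nonneg fun i _ =>
      Finset.sum_nonneg fun B _ => hgap i B).1 h0 i (Finset.mem_univ i)
    have h := (Finset.sum_eq_zero_iff_of_nonneg fun B _ => hgap i B).1 h B (Finset.mem_univ B)
    linarith [(mul_eq_zero.1 h).resolve_right hB]

/-- As bundles are nonempty, the total demand served is at most the total supply. -/
theorem sum_le_sum_supply {σ : G → ℝ} {x : N → Bundle G k → ℝ} (hx : Feasible σ x) :
    ∑ i, ∑ B, x i B ≤ ∑ j, σ j := by
  have h := sum_price_mul (fun _ => 1) x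
  simp only [mul_one] at h
  calc ∑ i, ∑ B, x i B ≤ ∑ i, ∑ B, price (fun _ : G => (1 : ℝ)) B * x i B := by
        refine Finset.sum_le_sum fun i _ => Finset.sum_le_sum fun B _ =>
          le_mul_of_one_le_left (hx.1 i B) ?_
        simp only [price, mul_one]
        exact_mod_cast B.2.1
    _ = ∑ j, usage x j := h
    _ ≤ ∑ j, σ j := Finset.sum_le_sum fun j _ => hx.2.2 j

/-- A group of agents that is larger than the total supply contains an agent that is not fully
served. -/
theorem exists_sum_lt_one {σ : G → ℝ} {x : N → Bundle G k → ℝ} (hx : Feasible σ x)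
    (T : Finset N) (hT : ∑ j, σ j < T.card) : ∃ i ∈ T, ∑ B, x i B < 1 := by
  by_contra! h
  have h1 : (T.card : ℝ) ≤ ∑ i ∈ T, ∑ B, x i B := by
    simpa using Finset.sum_le_sum h
  have h2 : ∑ i ∈ T, ∑ B, x i B ≤ ∑ i, ∑ B, x i B :=
    Finset.sum_le_sum_of_subset_of_nonneg (Finset.subset_univ T) fun i _ _ =>
      Finset.sum_nonneg fun B _ => hx.1 i B
  linarith [sum_le_sum_supply hx]

/-- Optimal dual prices are bounded in terms of any bound on the objective coefficients. -/
theorem IsDualOptimal.price_le {v : N → Bundle G k → ℝ} {σ : G → ℝ} {α : N → ℝ} {p : G → ℝ}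
    (hp : IsDualOptimal v σ α p) (hσ : ∀ j, 0 < σ j) {V : ℝ} (hV : 0 ≤ V)
    (hv : ∀ i B, v i B ≤ V) (j : G) : σ j * p j ≤ Fintype.card N * V := by
  -- Comparison with the dual point that has zero prices and `α = V` for all agents.
  have h := hp.2 (fun _ => V) 0 ⟨fun _ => hV, fun _ => le_rfl, fun i B => by
    simpa [price] using hv i B⟩
  have h1 : σ j * p j ≤ ∑ j, σ j * p j :=
    Finset.single_le_sum (f := fun j => σ j * p j)
      (fun j _ => mul_nonneg (hσ j).le (hp.1.2.1 j)) (Finset.mem_univ j)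
  have h2 : 0 ≤ ∑ i, α i := Finset.sum_nonneg fun i _ => hp.1.1 i
  simp only [dualValue, Pi.zero_apply, mul_zero, Finset.sum_const_zero, add_zero,
    Finset.sum_const, Finset.card_univ, nsmul_eq_mul] at h
  linarith

end LinearPrograms

/-! ### Rounding and lotteries preserve the support -/

section Support

variable {N G : Type*} [Fintype G] {k : ℕ}

/-- The nonnegative points that satisfy (Demand) and vanish wherever `x` does. -/
def demandFace (x : N → Bundle G k → ℝ) : Set (N → Bundle G k → ℝ) :=
  {z | (∀ i B, 0 ≤ z i B) ∧ (∀ i, ∑ B, z i B ≤ 1) ∧ ∀ i B, x i B = 0 → z i B = 0}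

theorem convex_demandFace (x : N → Bundle G k → ℝ) : Convex ℝ (demandFace x) := by
  rintro z ⟨h0, h1, h2⟩ z' ⟨h0', h1', h2'⟩ s t hs ht hst
  refine ⟨fun i B => ?_, fun i => ?_, fun i B h => ?_⟩
  · exact add_nonneg (mul_nonneg hs (h0 i B)) (mul_nonneg ht (h0' i B))
  · simp only [Pi.add_apply, Pi.smul_apply, smul_eq_mul, Finset.sum_add_distrib,
      ← Finset.mul_sum]
    nlinarith [h1 i, h1' i]
  · simp [h2 i B h, h2' i B h]

/-- Iterative rounding does not leave the demand face. -/
theorem IsIR.mem_demandFace [Fintype N] {σ : G → ℝ} {x z c z' : N → Bundle G k → ℝ}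
    (h : IsIR σ z c z') (hz : z ∈ demandFace x) : z' ∈ demandFace x := by
  obtain ⟨A, hA, -⟩ := h
  suffices ∀ st, Relation.ReflTransGen (IRStep σ c {i | ∑ B, z i B = 1}) (z, Set.univ) st →
      st.1 ∈ demandFace x from this _ hA
  intro st hst
  induction hst with
  | refl => exact hz
  | @tail st st' _ hstep ih =>
    obtain ⟨h0, hfix, heq, hle, -⟩ := hstep.2.1.1
    refine ⟨h0, fun i => ?_, fun i B hB => ?_⟩
    · by_cases hi : i ∈ {i | ∑ B, z i B = 1}
      · exact (heq i hi).le
      · exact hle i hi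
    -- A zero entry is not fractional, so the round freezes it. Rounds may drop supply constraints
    -- but never demand constraints.
    · have hzero := ih.2.2 i B hB
      rw [hfix i B (by simp [Fractional, hzero]), hzero]

/-- All points of the lottery construction for `x` lie in the demand face of `x`. -/
theorem IsLotterySet.subset_demandFace [Fintype N] {v x : N → Bundle G k → ℝ} {σ : G → ℝ} {δε tol : ℝ}
    {F : Set (N → Bundle G k → ℝ)} (h : IsLotterySet v σ δε tol x F) (hx : x ∈ demandFace x) :
    F ⊆ demandFace x := by
  obtain ⟨x', x'', hx', hx'', hF⟩ := h
  induction hF with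
  | refl =>
    rintro z (rfl | rfl)
    · exact hx'.mem_demandFace hx
    · exact hx''.mem_demandFace hx
  | tail _ hstep ih =>
    obtain ⟨y, F', δ, z, zbar, hy, -, hF', -, -, hz, hfeas, hIR, rfl⟩ := hstep
    -- The new point lies beyond `x`, but on the line through `x` and `y`, which both vanish off the
    -- support of `x`; its sign and demand conditions come from the choice of step length.
    have hyx := convexHull_min ih (convex_demandFace x) hy.1
    refine Set.insert_subset (hIR.mem_demandFace ⟨hfeas.1, hfeas.2.1, fun i B hB => ?_⟩)
      (hF'.prop.1.trans ih)
    simp [hz, hB, hyx.2.2 i B hB]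

end Support

/-! ### Random draws and payoff bounds -/

section Mechanisms

variable {Θ G : Type*} [Fintype G]

/-- The range of the weights and supply reductions. -/
def IsTypicalDraw (P : Auction Θ G) (d : Draw Θ (G := G) P.k) : Prop :=
  (∀ q, d.1 q ∈ Set.Icc (1 - P.δw) (1 + P.δw)) ∧ ∀ j, d.2 j ∈ Set.Icc P.δε (2 * P.δε)

theorem isProbabilityMeasure_unif {a b : ℝ} (h : a < b) : IsProbabilityMeasure (unif a b) :=
  ProbabilityTheory.cond_isProbabilityMeasure_of_finite (by simp [h]) (by simp)

theorem ae_unif_mem (a b : ℝ) : ∀ᵐ x ∂unif a b, x ∈ Set.Icc a b :=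
  ProbabilityTheory.ae_cond_mem measurableSet_Icc

theorem isProbabilityMeasure_drawLaw [Fintype Θ] (P : Auction Θ G) (hw0 : 0 < P.δw)
    (he0 : 0 < P.δε) : IsProbabilityMeasure (drawLaw P) := by
  have := isProbabilityMeasure_unif (show 1 - P.δw < 1 + P.δw by linarith)
  have := isProbabilityMeasure_unif (show P.δε < 2 * P.δε by linarith)
  unfold drawLaw
  infer_instance

theorem ae_isTypicalDraw [Fintype Θ] (P : Auction Θ G) (hw0 : 0 < P.δw) (he0 : 0 < P.δε) :
    ∀ᵐ d ∂drawLaw P, IsTypicalDraw P d := by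
  have := isProbabilityMeasure_unif (show 1 - P.δw < 1 + P.δw by linarith)
  have := isProbabilityMeasure_unif (show P.δε < 2 * P.δε by linarith)
  have h1 : ∀ᵐ d ∂drawLaw P, ∀ q, d.1 q ∈ Set.Icc (1 - P.δw) (1 + P.δw) :=
    ae_all_iff.2 fun q =>
      ((measurePreserving_eval (fun _ : Θ × Bundle G P.k => unif (1 - P.δw) (1 + P.δw)) q).comp
        measurePreserving_fst).quasiMeasurePreserving.ae (ae_unif_mem _ _)
  have h2 : ∀ᵐ d ∂drawLaw P, ∀ j, d.2 j ∈ Set.Icc P.δε (2 * P.δε) :=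
    ae_all_iff.2 fun j =>
      ((measurePreserving_eval (fun _ : G => unif P.δε (2 * P.δε)) j).comp
        measurePreserving_snd).quasiMeasurePreserving.ae (ae_unif_mem _ _)
  filter_upwards [h1, h2] with d hd1 hd2 using ⟨hd1, hd2⟩

theorem IsTypicalDraw.reducedSupply_pos {P : Auction Θ G} {d : Draw Θ (G := G) P.k}
    (hd : IsTypicalDraw P d) (hs : ∀ j, 2 * P.δε < (P.s j : ℝ)) (j : G) :
    0 < reducedSupply P d j := by
  have := (hd.2 j).2
  have := hs j
  simp only [reducedSupply]
  linarith

/-- If the agents of type `θ` outnumber the supply, then prices are at least their weighted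
valuations. -/
theorem weighted_le_price {P : Auction Θ G} [DecidableEq Θ] {d : Draw Θ (G := G) P.k}
    (hd : IsTypicalDraw P d) (he0 : 0 < P.δε) (hs : ∀ j, 2 * P.δε < (P.s j : ℝ)) {n : ℕ}
    {β : Fin n → Θ} {x : Fin n → Bundle G P.k → ℝ} {α : Fin n → ℝ} {p : G → ℝ}
    (hx : IsPrimalOptimal (weighted P β d) (reducedSupply P d) x)
    (hp : IsDualOptimal (weighted P β d) (reducedSupply P d) α p) {θ : Θ}
    (hθ : ∑ j, P.s j < (Finset.univ.filter fun i => β i = θ).card) (B : Bundle G P.k) :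
    d.1 (θ, B) * P.u θ B ≤ price p B := by
  have hsum : ∑ j, reducedSupply P d j ≤ ((∑ j, P.s j : ℕ) : ℝ) := by
    push_cast
    refine Finset.sum_le_sum fun j _ => ?_
    have := (hd.2 j).1
    simp only [reducedSupply]
    linarith
  obtain ⟨i, hi, hlt⟩ := exists_sum_lt_one hx.1 (Finset.univ.filter fun i => β i = θ)
    (hsum.trans_lt (by exact_mod_cast hθ))
  -- The partly served agent has `α i = 0`, so its dual constraint bounds the price below.
  have hα := (complementary_slackness (hd.reducedSupply_pos hs) hx hp).1 i hlt
  have h := hp.1.2.2 i B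
  obtain rfl : β i = θ := by simpa using hi
  simp only [weighted, hα] at h
  linarith

/-- An average of quantities that are at most `C` wherever the weights are nonzero is at most `C`.
-/
theorem sum_lottery_le {A : Type*} [Fintype A] {lam g : A → ℝ} {C : ℝ} (h0 : ∀ a, 0 ≤ lam a)
    (h1 : ∑ a, lam a = 1) (h : ∀ a, lam a ≠ 0 → g a ≤ C) : ∑ a, lam a * g a ≤ C := by
  calc ∑ a, lam a * g a ≤ ∑ a, lam a * C := Finset.sum_le_sum fun a _ => by
        by_cases ha : lam a = 0
        · simp [ha]
        · exact mul_le_mul_of_nonneg_left (h a ha) (h0 a)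
    _ = C := by rw [← Finset.sum_mul, h1, one_mul]

/-- The payoff is at most `C ≥ 0` if the utility of every bundle that the agent may receive is. -/
theorem sum_lottery_mul_le {N : Type*} [Fintype N] [DecidableEq N] {k : ℕ}
    {v x : N → Bundle G k → ℝ} {σ σ' : G → ℝ} {δε tol C : ℝ}
    {lam : (N → Bundle G k → Bool) → ℝ} (hlam : IsLottery v σ δε tol x lam)
    (hx : Feasible σ' x) (i : N) {g : Bundle G k → ℝ} (hC : 0 ≤ C)
    (hg : ∀ B, x i B ≠ 0 → g B ≤ C) :
    ∑ a, lam a * ∑ B, g B * ofBool a i B ≤ C := by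
  obtain ⟨F, y, hF, -, -, h0, hmem, h1, -⟩ := hlam
  refine sum_lottery_le h0 h1 fun a ha => ?_
  -- Each drawn allocation gives agent `i` only bundles from the support of `x`, of total weight at
  -- most one. It may give nothing, hence `0 ≤ C`.
  obtain ⟨ha0, ha1, ha2⟩ :=
    hF.subset_demandFace ⟨hx.1, hx.2.1, fun _ _ h => h⟩ (hmem a ha)
  calc ∑ B, g B * ofBool a i B ≤ ∑ B, C * ofBool a i B := Finset.sum_le_sum fun B _ => by
        by_cases hB : x i B = 0
        · simp [ha2 i B hB]
        · exact mul_le_mul_of_nonneg_right (hg B hB) (ha0 i B)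
    _ = C * ∑ B, ofBool a i B := by rw [Finset.mul_sum]
    _ ≤ C := mul_le_of_le_one_right hC (ha1 i)

/-- After a misreport the support of `x` reflects the reported type, so here the bound is asked of
all bundles. -/
theorem payoff_le {P : Auction Θ G} {n : ℕ} {β : Fin n → Θ} {d : Draw Θ (G := G) P.k}
    {o : Outcome G P.k n} (ho : IsPOPTOutcome P β d o) (θ : Θ) (i : Fin n) {C : ℝ} (hC : 0 ≤ C)
    (h : ∀ B, P.u θ B - price o.prices B ≤ C) : payoff P θ i o ≤ C := by
  obtain ⟨⟨x, hx, hlam⟩, -⟩ := ho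
  exact sum_lottery_mul_le hlam hx.1 i hC fun B _ => h B

theorem price_nonneg {k : ℕ} {p : G → ℝ} (hp : ∀ j, 0 ≤ p j) (B : Bundle G k) :
    0 ≤ price p B :=
  Finset.sum_nonneg fun j _ => mul_nonneg (Nat.cast_nonneg _) (hp j)

/-- If the agents of type `θ` outnumber the supply, then no agent of true type `θ` gains more
than half of the acceptable error, whatever it reports. -/
theorem payoff_le_half {P : Auction Θ G} [DecidableEq Θ] {d : Draw Θ (G := G) P.k}
    (hd : IsTypicalDraw P d) (he0 : 0 < P.δε) (hs : ∀ j, 2 * P.δε < (P.s j : ℝ)) {εu : ℝ}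
    (hu0 : 0 < εu) (hu : ∀ θ B, 2 * P.δw * P.u θ B ≤ εu) {n : ℕ} {β : Fin n → Θ}
    {o : Outcome G P.k n} (ho : IsPOPTOutcome P β d o) {θ : Θ}
    (hθ : ∑ j, P.s j < (Finset.univ.filter fun i => β i = θ).card) (i : Fin n) :
    payoff P θ i o ≤ εu / 2 := by
  refine payoff_le ho θ i (by linarith) fun B => ?_
  obtain ⟨⟨x, hx, -⟩, α, hp⟩ := ho
  have h1 := weighted_le_price hd he0 hs hx hp hθ B
  have h2 := price_nonneg hp.1.2.1 B
  have h3 := hu θ B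
  have h4 := (hd.1 (θ, B)).1
  -- For `u ≥ 0`, `u - p ≤ (1 - w) u ≤ δw u`; for `u ≤ 0`, nonnegative prices suffice.
  rcases le_total 0 (P.u θ B) with h | h
  · nlinarith
  · linarith

/-- An agent that reports truthfully loses at most half of the acceptable error. -/
theorem neg_half_le_payoff {P : Auction Θ G} {d : Draw Θ (G := G) P.k}
    (hd : IsTypicalDraw P d) (hw1 : P.δw < 1) (hs : ∀ j, 2 * P.δε < (P.s j : ℝ)) {εu : ℝ}
    (hu0 : 0 < εu) (hu : ∀ θ B, 2 * P.δw * P.u θ B ≤ εu) {n : ℕ} {β : Fin n → Θ}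
    {o : Outcome G P.k n} (ho : IsPOPTOutcome P β d o) (i : Fin n) :
    -(εu / 2) ≤ payoff P (β i) i o := by
  obtain ⟨⟨x, hx, hlam⟩, α, hp⟩ := ho
  have h := sum_lottery_mul_le hlam hx.1 i (C := εu / 2)
    (g := fun B => -(P.u (β i) B - price o.prices B)) (by linarith) fun B hB => by
      have h1 := (complementary_slackness (hd.reducedSupply_pos hs) hx hp).2 i B hB
      have h2 := price_nonneg hp.1.2.1 B
      have h3 := hu (β i) B
      have h4 := hd.1 (β i, B)
      have h5 := hp.1.1 i
      simp only [weighted] at h1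
      -- Here `w u = α + p ≥ 0`, and `w > 0` because `δw < 1`. With `u ≥ 0`, `p - u ≤ (w - 1) u ≤ δw
      -- u`.
      have h6 : 0 ≤ P.u (β i) B := by
        by_contra! hneg
        nlinarith [h4.1]
      nlinarith [h4.2]
  simp only [neg_mul, Finset.sum_neg_distrib, mul_neg] at h
  simp only [payoff]
  linarith

/-- The payoff is bounded uniformly in the draw. -/
theorem exists_abs_payoff_le [Fintype Θ] (P : Auction Θ G) (hw0 : 0 < P.δw) (hw1 : P.δw < 1)
    (hs : ∀ j, 2 * P.δε < (P.s j : ℝ)) (n : ℕ) :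
    ∃ C : ℝ, ∀ (β : Fin n → Θ) (d : Draw Θ (G := G) P.k) (o : Outcome G P.k n) (θ : Θ)
      (i : Fin n), IsTypicalDraw P d → IsPOPTOutcome P β d o → |payoff P θ i o| ≤ C := by
  -- The factor `2` dominates every weight, since `1 + δw < 2`.
  set V : ℝ := ∑ θ, ∑ B, 2 * |P.u θ B|
  have hV : 0 ≤ V := Finset.sum_nonneg fun θ _ => Finset.sum_nonneg fun B _ => by positivity
  have huV : ∀ θ B, 2 * |P.u θ B| ≤ V := fun θ B =>
    (Finset.single_le_sum (f := fun B => 2 * |P.u θ B|) (fun _ _ => by positivity)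
      (Finset.mem_univ B)).trans
    (Finset.single_le_sum (f := fun θ => ∑ B, 2 * |P.u θ B|)
      (fun _ _ => Finset.sum_nonneg fun _ _ => by positivity) (Finset.mem_univ θ))
  -- Bounds every bundle price: at most `k` units of each good, each priced by
  -- `IsDualOptimal.price_le` with reduced supply at least `s j - 2 δε`. The dependence on `n` is
  -- harmless, as only integrability is at stake.
  set K : ℝ := ∑ j, (P.k : ℝ) * (n * V / (P.s j - 2 * P.δε))
  have hK : 0 ≤ K := Finset.sum_nonneg fun j _ =>
    mul_nonneg (Nat.cast_nonneg _) (div_nonneg (by positivity) (by linarith [hs j]))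
  refine ⟨V + K, fun β d o θ i hd ho => ?_⟩
  obtain ⟨⟨x, hx, hlam⟩, α, hp⟩ := id ho
  have hv : ∀ i B, weighted P β d i B ≤ V := fun i B => by
    have h1 := hd.1 (β i, B)
    calc d.1 (β i, B) * P.u (β i) B ≤ d.1 (β i, B) * |P.u (β i) B| :=
          mul_le_mul_of_nonneg_left (le_abs_self _) (by linarith [h1.1])
      _ ≤ 2 * |P.u (β i) B| :=
          mul_le_mul_of_nonneg_right (by linarith [h1.2]) (abs_nonneg _)
      _ ≤ V := huV _ _
  have hpj : ∀ j, o.prices j ≤ n * V / (P.s j - 2 * P.δε) := fun j => by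
    rw [le_div_iff₀ (by linarith [hs j])]
    have h1 := hp.price_le (hd.reducedSupply_pos hs) hV hv j
    have h2 := (hd.2 j).2
    have h3 := hp.1.2.1 j
    simp only [reducedSupply, Fintype.card_fin] at h1
    nlinarith
  have hprice : ∀ B : Bundle G P.k, price o.prices B ≤ K := fun B =>
    Finset.sum_le_sum fun j _ => mul_le_mul
      (by exact_mod_cast (Finset.single_le_sum (f := B.1) (fun _ _ => Nat.zero_le _)
        (Finset.mem_univ j)).trans B.2.2) (hpj j) (hp.1.2.1 j) (Nat.cast_nonneg _)
  refine abs_le.2 ⟨?_, ?_⟩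
  · have h := sum_lottery_mul_le hlam hx.1 i (C := V + K)
      (g := fun B => -(P.u θ B - price o.prices B)) (by linarith) fun B _ => by
        linarith [huV θ B, neg_abs_le (P.u θ B), abs_nonneg (P.u θ B), hprice B]
    simp only [neg_mul, Finset.sum_neg_distrib, mul_neg] at h
    simp only [payoff]
    linarith
  · refine payoff_le ho θ i (by linarith) fun B => ?_
    linarith [huV θ B, le_abs_self (P.u θ B), abs_nonneg (P.u θ B),
      price_nonneg hp.1.2.1 B]

/-- The payoff is a polynomial in finitely many measurable prices and probabilities, and it is
almost surely bounded under a probability measure. -/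
theorem integrable_payoff [Fintype Θ] (P : Auction Θ G) (hw0 : 0 < P.δw) (hw1 : P.δw < 1)
    (he0 : 0 < P.δε) (hs : ∀ j, 2 * P.δε < (P.s j : ℝ)) {M : Mechanism Θ G P.k}
    (hM : IsPOPT P M) {n : ℕ} (β : Fin n → Θ) (θ : Θ) (i : Fin n) :
    Integrable (fun d => payoff P θ i (M n β d)) (drawLaw P) := by
  have := isProbabilityMeasure_drawLaw P hw0 he0
  obtain ⟨hout, hprices, hlottery⟩ := hM n β
  obtain ⟨C, hC⟩ := exists_abs_payoff_le P hw0 hw1 hs n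
  refine Integrable.of_bound (C := C) (AEMeasurable.aestronglyMeasurable ?_) ?_
  · unfold payoff price
    refine Finset.aemeasurable_fun_sum _ fun a _ => (hlottery a).mul ?_
    refine Finset.aemeasurable_fun_sum _ fun B _ => AEMeasurable.mul_const ?_ _
    exact aemeasurable_const.sub
      (Finset.aemeasurable_fun_sum _ fun j _ => (hprices j).const_mul _)
  · filter_upwards [hout, ae_isTypicalDraw P hw0 he0] with d ho hd
    exact hC β d _ θ i hd ho

/-- A single misreport removes at most one agent from a group of the same type. -/
theorem card_filter_le_card_filter_update [DecidableEq Θ] {n : ℕ} (β : Fin n → Θ) (i : Fin n)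
    (ζ θ : Θ) : (Finset.univ.filter fun l => β l = θ).card
      ≤ (Finset.univ.filter fun l => Function.update β i ζ l = θ).card + 1 := by
  refine (Finset.card_le_card fun l hl => ?_).trans (Finset.card_insert_le i _)
  by_cases hli : l = i
  · simp [hli]
  · simpa [hli] using hl

end Mechanisms

end POPT

theorem theorem3p2 {Θ G : Type*} [Fintype Θ] [DecidableEq Θ] [Fintype G]
    (P : POPT.Auction Θ G)
    (hw0 : 0 < P.δw) (hw1 : P.δw < 1)
    (he0 : 0 < P.δε) (hs : ∀ j, 2 * P.δε < (P.s j : ℝ))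
    (ht : 0 < P.tol)
    (εu : ℝ) (hu0 : 0 < εu) (hu : ∀ θ B, 2 * P.δw * P.u θ B ≤ εu)
    (M : POPT.Mechanism Θ G P.k) (hM : POPT.IsPOPT P M) :
    POPT.AsymptoticallyStrategyProof P M εu := by
  open POPT in
  intro ε₀ hε₀
  -- The extra one compensates for the misreporting agent, who may leave its type group.
  refine ⟨∑ j, P.s j + 1, fun n β hβ i ζ => ?_⟩
  have := isProbabilityMeasure_drawLaw P hw0 he0
  have hint := integrable_payoff P hw0 hw1 he0 hs hM β (β i) i
  have hint' := integrable_payoff P hw0 hw1 he0 hs hM (Function.update β i ζ) (β i) i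
  have hcard : ∑ j, P.s j
      < (Finset.univ.filter fun l => Function.update β i ζ l = β i).card := by
    have h1 := hβ (β i)
    rw [Fintype.card_subtype] at h1
    have h2 := card_filter_le_card_filter_update β i ζ (β i)
    omega
  have hlow : -(εu / 2) ≤ ∫ d, payoff P (β i) i (M n β d) ∂drawLaw P := by
    have h := integral_mono_ae (integrable_const (-(εu / 2))) hint (by
      filter_upwards [(hM n β).1, ae_isTypicalDraw P hw0 he0] with d ho hd
      exact neg_half_le_payoff hd hw1 hs hu0 hu ho i)
    simpa using h
  have hupp : ∫ d, payoff P (β i) i (M n (Function.update β i ζ) d) ∂drawLaw P ≤ εu / 2 := by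
    have h := integral_mono_ae hint' (integrable_const (εu / 2)) (by
      filter_upwards [(hM n (Function.update β i ζ)).1, ae_isTypicalDraw P hw0 he0] with d ho hd
      exact payoff_le_half hd he0 hs hu0 hu ho hcard i)
    simpa using h
  -- The two halves add up to `εu`; of `ε₀` only positivity matters.
  exact ⟨hint, hint', by linarith⟩
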